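/- Let $\lambda\ge\aleph_2$ be a cardinal and let $I$ be a set of cardinality $\lambda$. Then (in ZFC) there is a regular ultrafilter $\mathcal D_*$ on $I$ such that $\mathrm{lcf}(\aleph_0,\mathcal D_*)\ge\lambda^+$ but $\mathcal D_*$ does not saturate the theory of the random graph. Here an ultrafilter $\mathcal D$ on $I$ is *regular* if there are sets $X_i\in\mathcal D$ for $i<\lambda$ such that $\bigcap_{i\in\sigma}X_i=\emptyset$ for every infinite $\sigma\subseteq\lambda$. The cardinal $\mathrm{lcf}(\aleph_0,\mathcal D)$ is the coinitiality of the set of elements of the ultrapower $(\mathbb N,<)^I/\mathcal D$ that lie above the diagonal copy of $\mathbb N$. A regular ultrafilter $\mathcal D$ on $I$ *saturates* a complete countable first-order theory $T$ if for every model $M$ of $T$ the ultrapower $M^I/\mathcal D$ is $\lambda^+$-saturated. The theory of the random graph says that the edge relation is irreflexive and symmetric and that for any finite disjoint sets of vertices $A$ and $B$ there is a vertex outside $A\cup B$ adjacent to every vertex of $A$ and to no vertex of $B$. -/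

import Mathlib

open FirstOrder FirstOrder.Language

universe u

namespace RegularUltrafilter

/-- A filter on `I` is regular if there is a regularizing family of `|I|` many sets (indexed here by
`I` itself): members of the filter, any infinitely many of which have empty intersection. -/
def IsRegular {I : Type u} (D : Filter I) : Prop :=
  ∃ X : I → Set I, (∀ i, X i ∈ D) ∧ ∀ σ : Set I, σ.Infinite → (⋂ i ∈ σ, X i) = ∅

/-- The elements of the ultrapower `(ℕ, <)^I / D` that lie above the diagonal copy of `ℕ`. -/
abbrev AboveNat {I : Type u} (D : Ultrafilter I) : Type u :=
  {x : (D : Filter I).Germ ℕ // ∀ n : ℕ, Filter.Germ.const n < x}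

/-- The lower cofinality `lcf(ℵ₀, D)`: the coinitiality of the set of elements of `(ℕ, <)^I / D`
above the diagonal copy of `ℕ`, that is, the cofinality of its order dual. -/
noncomputable def lcf {I : Type u} (D : Ultrafilter I) : Cardinal.{u} :=
  Order.cof (AboveNat D)ᵒᵈ

/-- A structure `N` is `κ`-saturated if for every set `A` of fewer than `κ` parameters from `N`,
every set of formulas over `A` in one free variable which is finitely satisfiable in `N` is
realized in `N`. -/
def IsSaturated (L : FirstOrder.Language.{0, 0}) (κ : Cardinal.{u}) (N : Type u) [L.Structure N] : Prop :=
  ∀ A : Set N, Cardinal.mk A < κ →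
    ∀ p : Set (L[[A]].Formula Unit),
      (∀ s : Finset (L[[A]].Formula Unit), (s : Set (L[[A]].Formula Unit)) ⊆ p →
        ∃ b : N, ∀ φ ∈ s, φ.Realize (fun _ => b)) →
      ∃ b : N, ∀ φ ∈ p, φ.Realize (fun _ => b)

/-- An ultrafilter `D` on `I` saturates the theory `T` if for every model `M` of `T` the ultrapower
`M^I / D` is `|I|⁺`-saturated. -/
def Saturates {I : Type u} (D : Ultrafilter I) {L : FirstOrder.Language.{0, 0}} (T : L.Theory) : Prop :=
  ∀ (M : Type u) [L.Structure M] [Nonempty M], M ⊨ T →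
    IsSaturated L (Order.succ (Cardinal.mk I)) ((D : Filter I).Product (fun _ : I => M))

/-- The extension axiom for `m` and `n`: for all `x₁, …, xₘ` and `y₁, …, yₙ` with all `xᵢ ≠ yⱼ`
there is a vertex `z`, different from all of them, that is adjacent to every `xᵢ`
and to no `yⱼ`. -/
noncomputable def extensionAxiom (m n : ℕ) : Language.graph.Sentence :=
  Formula.iAlls (Fin m ⊕ Fin n) <|
    (Formula.iInf fun p : Fin m × Fin n =>
      ((Term.var (Sum.inr (Sum.inl p.1))).equal (Term.var (Sum.inr (Sum.inr p.2)))).not).imp <|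
    Formula.iExs Unit <|
      (Formula.iInf fun v : Fin m ⊕ Fin n =>
        ((Term.var (Sum.inr ())).equal (Term.var (Sum.inl (Sum.inr v)))).not) ⊓
      ((Formula.iInf fun i : Fin m =>
        adj.formula₂ (Term.var (Sum.inr ())) (Term.var (Sum.inl (Sum.inr (Sum.inl i))))) ⊓
      (Formula.iInf fun j : Fin n =>
        (adj.formula₂ (Term.var (Sum.inr ()))
          (Term.var (Sum.inl (Sum.inr (Sum.inr j))))).not))

/-- The theory of the random graph: the axioms of simple graphs (an irreflexive symmetric edge
relation) together with all extension axioms. -/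
noncomputable def randomGraphTheory : Language.graph.Theory :=
  Theory.simpleGraph ∪ {φ | ∃ m n : ℕ, φ = extensionAxiom m n}

end RegularUltrafilter

/-!
The ultrafilter is built on the product space `K → ℕ` for an index set `K` of size at most `2 ^ |I|`
and then transferred to `I`.

*Transfer.* There is a family of functions `I → ℕ`, indexed by `K`, that is independent modulo a
regular filter on `I` (`exists_isRegular_indepMod`). By Zorn's lemma this filter extends to a filter
`D` that is maximal with this property. Then every subset of `I` corresponds, modulo `D`, to an open
subset of `K → ℕ` (`forced`) and is decided by a countable set of coordinates, its support
(`IndepMod.exists_countable_support`). An ultrafilter `U` on `K → ℕ` that contains all sets with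
dense interior therefore induces an ultrafilter `E` on `I` that extends `D`
(`IndepMod.exists_ultrafilter`). As it extends `D`, it is regular.

*The ultrafilter `U`.* The coordinates are arranged along the well-order `W = ω₁ + |I|⁺`, two to each
element of `W`, and `U` is obtained by recursion along `W` (`exists_generic_ultrafilter`). At a stage
`α` in the part `ω₁`, the two coordinates at `α` are required to be distinct numbers that belong to
the same sets, for all sets with support below `α` and in the part `|I|⁺`; this is consistent by the
pigeonhole principle (`exists_filter_symmetric`). At a stage `ξ` in the part `|I|⁺`, a coordinate is
required to be infinite and to be below every infinite number supported below `ξ`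
(`exists_filter_infinitesimal`). All these requirements are compatible because the filter of each
stage is invariant under prescribing standard values at the coordinates that are still to come.

*Lower cofinality.* Given `|I|` many infinite elements of `ℕ ^ I / E`, their supports are countable, so
some `ξ` in the part `|I|⁺` lies above all of them, and the element with index `ξ` is an infinite lower
bound.

*The random graph.* The pairs of functions with indices in `ω₁` yield elements `a α` and `b α` of an
ultrapower of the Rado graph, with `a α ≠ b β` for all `α` and `β`. The type of a vertex adjacent to
all `a α` and to no `b α` is finitely satisfiable. The neighbourhood of a realization would be an
internal set that separates the `a α` from the `b α` (`Saturates.exists_separation`). But an internal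
set has a countable support, which is bounded in `ω₁` by some `α`, so it contains `a α` if and only if
it contains `b α` (`not_separated_of_symmetric`).
-/

namespace RegularUltrafilter

open Filter Topology

/-! ### Building filters by recursion along a well-order -/

section Recursion

variable {X ι : Type*}

theorem inf_generate_neBot {F : Filter X} {S : Set (Set X)}
    (h : ∀ R ∈ F, ∀ t ⊆ S, t.Finite → ∃ x ∈ R, ∀ T ∈ t, x ∈ T) : (F ⊓ generate S).NeBot := by
  rw [inf_neBot_iff]
  intro R hR T hT
  obtain ⟨t, htS, htf, htT⟩ := mem_generate_iff.1 hT
  obtain ⟨x, hxR, hx⟩ := h R hR t htS htf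
  exact ⟨x, hxR, htT hx⟩

theorem tendsto_inf_generate {F : Filter X} {S : Set (Set X)} {m : X → X} (hF : Tendsto m F F)
    (hS : ∀ T ∈ S, m ⁻¹' T ∈ F ⊓ generate S) :
    Tendsto m (F ⊓ generate S) (F ⊓ generate S) := by
  rw [tendsto_inf]
  refine ⟨hF.mono_left inf_le_left, ?_⟩
  rw [Tendsto, le_generate_iff]
  exact hS

theorem mem_inf_generate {F : Filter X} {S : Set (Set X)} {T : Set X} (hT : T ∈ S) :
    T ∈ F ⊓ generate S :=
  mem_inf_of_right (GenerateSets.basic hT)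

/-- Construction of a filter by recursion along a well-order. At stage `ξ` a requirement `Good ξ` is
met by refining the current filter. What makes stage `ξ` possible is that the current filter is
still invariant under the maps in `M η` for all `η ≥ ξ`; only invariance under `M ξ` may be lost. -/
theorem exists_filter_of_forall_step [LinearOrder ι] [WellFoundedLT ι]
    (M : ι → Set (X → X)) (Good : ι → Filter X → Prop)
    (mono : ∀ ξ F F', F' ≤ F → Good ξ F → Good ξ F') (F₀ : Filter X) [F₀.NeBot]
    (inv₀ : ∀ η, ∀ m ∈ M η, Tendsto m F₀ F₀)
    (step : ∀ ξ F, F.NeBot → F ≤ F₀ → (∀ η, ξ ≤ η → ∀ m ∈ M η, Tendsto m F F) →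
      ∃ F' ≤ F, F'.NeBot ∧ (∀ η, ξ < η → ∀ m ∈ M η, Tendsto m F' F') ∧ Good ξ F') :
    ∃ F ≤ F₀, F.NeBot ∧ ∀ ξ, Good ξ F := by
  classical
  -- A total version of `step`, which leaves unsuitable filters unchanged.
  have next : ∀ ξ F, ∃ F' ≤ F, F.NeBot → F ≤ F₀ →
      (∀ η, ξ ≤ η → ∀ m ∈ M η, Tendsto m F F) →
      F'.NeBot ∧ (∀ η, ξ < η → ∀ m ∈ M η, Tendsto m F' F') ∧ Good ξ F' := by
    intro ξ F
    by_cases h : F.NeBot ∧ F ≤ F₀ ∧ ∀ η, ξ ≤ η → ∀ m ∈ M η, Tendsto m F F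
    · obtain ⟨F', h1, h2⟩ := step ξ F h.1 h.2.1 h.2.2
      exact ⟨F', h1, fun _ _ _ => h2⟩
    · exact ⟨F, le_rfl, fun h1 h2 h3 => absurd ⟨h1, h2, h3⟩ h⟩
  choose nx nx_le nx_spec using next
  let Fil : ι → Filter X := (wellFounded_lt (α := ι)).fix
    fun ξ rec => nx ξ (F₀ ⊓ ⨅ η : Set.Iio ξ, rec η.1 η.2)
  let pre : ι → Filter X := fun ξ => F₀ ⊓ ⨅ η : Set.Iio ξ, Fil η.1
  have Fil_eq : ∀ ξ, Fil ξ = nx ξ (pre ξ) := fun ξ => WellFounded.fix_eq _ _ _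
  have Fil_le : ∀ ξ, Fil ξ ≤ pre ξ := fun ξ => (Fil_eq ξ).trans_le (nx_le _ _)
  have Fil_le₀ : ∀ ξ, Fil ξ ≤ F₀ := fun ξ => (Fil_le ξ).trans inf_le_left
  have anti : ∀ η ξ, η ≤ ξ → Fil ξ ≤ Fil η := by
    intro η ξ h
    rcases h.eq_or_lt with rfl | h
    · exact le_rfl
    · exact (Fil_le ξ).trans (inf_le_right.trans (iInf_le (fun η : Set.Iio ξ => Fil η.1) ⟨η, h⟩))
  have neBot_inf : ∀ s : Set ι, (∀ η ∈ s, (Fil η).NeBot) → (F₀ ⊓ ⨅ η : s, Fil η.1).NeBot := by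
    intro s hs
    rcases s.eq_empty_or_nonempty with rfl | hne
    · simpa using ‹F₀.NeBot›
    · have : Nonempty s := hne.to_subtype
      rw [inf_eq_right.2 ((iInf_le _ (Classical.arbitrary s)).trans (Fil_le₀ _))]
      refine iInf_neBot_of_directed' (fun a b => ?_) (fun η => hs η.1 η.2)
      rcases le_total a b with h | h
      · exact ⟨b, anti _ _ h, le_rfl⟩
      · exact ⟨a, le_rfl, anti _ _ h⟩
  have main : ∀ ξ, (Fil ξ).NeBot ∧ (∀ η, ξ < η → ∀ m ∈ M η, Tendsto m (Fil ξ) (Fil ξ)) ∧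
      Good ξ (Fil ξ) := by
    intro ξ
    induction ξ using (wellFounded_lt (α := ι)).induction with
    | _ ξ ih =>
      have h := nx_spec ξ (pre ξ) (neBot_inf _ fun η hη => (ih η hη).1) inf_le_left ?_
      · rwa [← Fil_eq] at h
      · intro ζ hζ m hm
        rw [tendsto_inf, tendsto_iInf]
        refine ⟨(inv₀ ζ m hm).mono_left inf_le_left, fun η => ?_⟩
        exact ((ih η.1 η.2).2.1 ζ (lt_of_lt_of_le η.2 hζ) m hm).mono_left
          (inf_le_right.trans (iInf_le (fun η : Set.Iio ξ => Fil η.1) η))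
  refine ⟨F₀ ⊓ ⨅ η : (Set.univ : Set ι), Fil η.1, inf_le_left,
    neBot_inf _ fun η _ => (main η).1, fun ξ => ?_⟩
  exact mono ξ _ _ (inf_le_right.trans
    (iInf_le (fun η : (Set.univ : Set ι) => Fil η.1) ⟨ξ, trivial⟩)) (main ξ).2.2

end Recursion

/-! ### Sets with dense interior -/

section DenseInterior

/-- The filter of all sets with dense interior, that is, of the complements of nowhere dense
sets. -/
def denseInterior (X : Type*) [TopologicalSpace X] : Filter X where
  sets := {S | Dense (interior S)}
  univ_sets := by simp
  sets_of_superset h hST := h.mono (interior_mono hST)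
  inter_sets h h' := by
    simp only [Set.mem_ofPred_eq, interior_inter] at *
    exact h.inter_of_isOpen_left h' isOpen_interior

theorem mem_denseInterior {X : Type*} [TopologicalSpace X] {S : Set X} :
    S ∈ denseInterior X ↔ Dense (interior S) := Iff.rfl

instance {X : Type*} [TopologicalSpace X] [Nonempty X] : (denseInterior X).NeBot := by
  refine ⟨fun h => ?_⟩
  have : (∅ : Set X) ∈ denseInterior X := h ▸ mem_bot
  rw [mem_denseInterior, interior_empty] at this
  exact Set.not_nonempty_empty this.nonempty

theorem isOpen_setOf_apply_eq {K : Type*} (k : K) (n : ℕ) : IsOpen {x : K → ℕ | x k = n} :=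
  (isOpen_discrete ({n} : Set ℕ)).preimage (continuous_apply (A := fun _ : K => ℕ) k)

variable {K : Type*} [DecidableEq K]

/-- The filter of sets with dense interior is invariant under prescribing a coordinate. -/
theorem tendsto_update_denseInterior (k : K) (n : ℕ) :
    Tendsto (fun x : K → ℕ => Function.update x k n) (denseInterior _) (denseInterior _) := by
  intro S hS
  rw [mem_denseInterior] at hS
  have hcont : Continuous fun x : K → ℕ => Function.update x k n := by fun_prop
  refine Dense.mono (interior_maximal (Set.preimage_mono interior_subset)
    (isOpen_interior.preimage hcont)) ?_
  rw [dense_iff_inter_open]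
  rintro V hV ⟨x, hx⟩
  -- Look for a point of `interior S` with value `n` at `k` that lies in `V` once its value at `k`
  -- is reset to `x k`.
  have hcont' : Continuous fun y : K → ℕ => Function.update y k (x k) := by fun_prop
  obtain ⟨y, ⟨hyV, hyk⟩, hyS⟩ := hS.inter_open_nonempty
    ((fun y : K → ℕ => Function.update y k (x k)) ⁻¹' V ∩ {y | y k = n})
    ((hV.preimage hcont').inter (isOpen_setOf_apply_eq k n))
    ⟨Function.update x k n, by simpa using hx, by simp⟩
  refine ⟨_, hyV, ?_⟩
  have : Function.update (Function.update y k (x k)) k n = y := by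
    rw [Function.update_idem, ← hyk, Function.update_eq_self]
  simpa [this] using hyS

/-- Deciding which of countably many sets with dense interior to take by the value of one
coordinate again gives a set with dense interior. -/
theorem setOf_mem_apply_mem_denseInterior {K : Type*} {Z : ℕ → Set (K → ℕ)}
    (hZ : ∀ n, Z n ∈ denseInterior (K → ℕ)) (k : K) : {x | x ∈ Z (x k)} ∈ denseInterior (K → ℕ) := by
  have hopen := isOpen_setOf_apply_eq k
  refine Dense.mono (s₁ := ⋃ n, {x | x k = n} ∩ interior (Z n))
    (interior_maximal ?_ (isOpen_iUnion fun n => (hopen n).inter isOpen_interior)) ?_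
  · intro x hx
    obtain ⟨n, rfl, hx⟩ := Set.mem_iUnion.1 hx
    exact (interior_subset hx : x ∈ Z (x k))
  · rw [dense_iff_inter_open]
    rintro V hV ⟨x, hx⟩
    obtain ⟨y, ⟨hyV, hyk⟩, hy⟩ := (mem_denseInterior.1 (hZ (x k))).inter_open_nonempty
      (V ∩ {y | y k = x k}) (hV.inter (hopen _)) ⟨x, hx, rfl⟩
    exact ⟨y, hyV, Set.mem_iUnion.2 ⟨_, hyk, hy⟩⟩

end DenseInterior

/-! ### A generic ultrafilter on `W × Bool → ℕ` -/

section Generic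

variable {W : Type*} [LinearOrder W]

/-- The self-maps of `W × Bool → ℕ` that prescribe the value of one of the two coordinates
at `w`. -/
def coordUpdates (w : W) : Set ((W × Bool → ℕ) → (W × Bool → ℕ)) :=
  {m | ∃ i n, m = fun x => Function.update x (w, i) n}

/-- The step for `α ∈ L`: the two coordinates at `α` are made distinct, but they belong to
the same sets among all `Y` that depend only on coordinates before `α` and outside `L`. Finitely
many such `Y` colour `ℕ` by finitely many colours, so by the pigeonhole principle there are two
distinct values of the same colour; invariance allows these to be prescribed at `α`. -/
theorem exists_filter_symmetric (L : Set W) {α : W} (hL : ∀ w, w ∉ L → α < w)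
    {F : Filter (W × Bool → ℕ)} (hF : F.NeBot)
    (inv : ∀ η, α ≤ η → ∀ m ∈ coordUpdates η, Tendsto m F F) :
    ∃ F' ≤ F, F'.NeBot ∧ (∀ η, α < η → ∀ m ∈ coordUpdates η, Tendsto m F' F') ∧
      {x | x (α, false) ≠ x (α, true)} ∈ F' ∧
      ∀ Y : ℕ → Set (W × Bool → ℕ),
        (∀ n, DependsOn (fun x => x ∈ Y n) {k | k.1 < α ∨ k.1 ∉ L}) →
        {x | x ∈ Y (x (α, false)) ↔ x ∈ Y (x (α, true))} ∈ F' := by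
  let S : Set (Set (W × Bool → ℕ)) := {T | ∃ Y : ℕ → Set (W × Bool → ℕ),
    (∀ n, DependsOn (fun x => x ∈ Y n) {k | k.1 < α ∨ k.1 ∉ L}) ∧
    T = {x | x (α, false) ≠ x (α, true) ∧ (x ∈ Y (x (α, false)) ↔ x ∈ Y (x (α, true)))}}
  have mem : ∀ Y : ℕ → Set (W × Bool → ℕ),
      (∀ n, DependsOn (fun x => x ∈ Y n) {k | k.1 < α ∨ k.1 ∉ L}) →
      {x | x (α, false) ≠ x (α, true) ∧ (x ∈ Y (x (α, false)) ↔ x ∈ Y (x (α, true)))} ∈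
        F ⊓ generate S := fun Y hY => mem_inf_generate ⟨Y, hY, rfl⟩
  refine ⟨F ⊓ generate S, inf_le_left, inf_generate_neBot ?_, ?_, ?_, ?_⟩
  · intro R hR t htS htf
    have ht : ∀ T ∈ t, ∃ Y : ℕ → Set (W × Bool → ℕ), _ := fun T hT => htS hT
    choose! Y hY hT using ht
    have : Fintype t := htf.fintype
    -- One value more than there are colours.
    let N := Fintype.card (t → Prop) + 1
    let up : (W × Bool → ℕ) → ℕ → ℕ → (W × Bool → ℕ) := fun x a b =>
      Function.update (Function.update x (α, false) a) (α, true) b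
    have hup : ∀ᶠ x in F, ∀ a b : Fin N, up x a b ∈ R := by
      simp only [eventually_all]
      intro a b
      exact (inv α le_rfl _ ⟨true, b, rfl⟩).comp (inv α le_rfl _ ⟨false, a, rfl⟩) hR
    obtain ⟨x, hx⟩ := hup.exists
    have hdep : ∀ T ∈ t, ∀ n a b, up x a b ∈ Y T n ↔ x ∈ Y T n := by
      intro T hT n a b
      refine iff_of_eq (hY T hT n fun k hk => ?_)
      have : k.1 ≠ α := by
        rintro rfl
        rcases hk with hk | hk
        · exact lt_irrefl _ hk
        · exact lt_irrefl _ (hL _ hk)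
      have h1 : k ≠ (α, true) := fun h => this (by rw [h])
      have h2 : k ≠ (α, false) := fun h => this (by rw [h])
      simp [up, h1, h2]
    obtain ⟨a, b, hab, hc⟩ := Fintype.exists_ne_map_eq_of_card_lt
      (fun (a : Fin N) (T : t) => x ∈ Y T a) (by simp [N])
    refine ⟨up x a b, hx a b, fun T hTt => ?_⟩
    rw [hT T hTt]
    have e1 : up x a b (α, false) = a := by simp [up]
    have e2 : up x a b (α, true) = b := by simp [up]
    simp only [Set.mem_ofPred_eq, e1, e2, hdep T hTt]
    exact ⟨fun h => hab (Fin.ext h), iff_of_eq (congrFun hc ⟨T, hTt⟩)⟩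
  · -- Prescribing a later coordinate turns the requirement for `Y` into that for another `Y`.
    rintro η hη m ⟨i, n, rfl⟩
    refine tendsto_inf_generate (inv η hη.le _ ⟨i, n, rfl⟩) ?_
    rintro T ⟨Y, hY, rfl⟩
    have hne : ∀ j, ((α, j) : W × Bool) ≠ (η, i) := fun j h => hη.ne (congrArg Prod.fst h)
    convert mem (fun l => (fun x => Function.update x (η, i) n) ⁻¹' Y l) ?_ using 1
    · ext x
      simp [hne]
    · intro l x y hxy
      refine hY l fun k hk => ?_
      by_cases h : k = (η, i)
      · subst h; simp
      · simp [h, hxy k hk]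
  · exact mem_of_superset (mem (fun _ => ∅) fun n x y _ => rfl) fun x hx => hx.1
  · intro Y hY
    exact mem_of_superset (mem Y hY) fun x hx => hx.2

/-- The step for `ξ ∉ L`: the coordinate at `(ξ, false)` is made infinite, but smaller than
every infinite natural number that is named before `ξ`. Such a name is given by the sets
`P n = {x | f x ≤ n}`; it is infinite if no `P n` is large, and `f x ≥ x (ξ, false)` means that
`x ∉ P m` for all `m < x (ξ, false)`. -/
theorem exists_filter_infinitesimal {ξ : W} {F : Filter (W × Bool → ℕ)} (hF : F.NeBot)
    (inv : ∀ η, ξ ≤ η → ∀ m ∈ coordUpdates η, Tendsto m F F) :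
    ∃ F' ≤ F, F'.NeBot ∧ (∀ η, ξ < η → ∀ m ∈ coordUpdates η, Tendsto m F' F') ∧
      (∀ n, {x | n < x (ξ, false)} ∈ F') ∧
      ∀ P : ℕ → Set (W × Bool → ℕ), (∀ n, DependsOn (fun x => x ∈ P n) {k | k.1 < ξ}) →
        (∃ n, P n ∈ F') ∨ {x | ∀ m < x (ξ, false), x ∉ P m} ∈ F' := by
  -- The sets that depend only on coordinates before `ξ` are decided first, which costs no
  -- invariance.
  let V := Ultrafilter.of F
  have hV : ↑V ≤ F := Ultrafilter.of_le F
  let S₁ : Set (Set (W × Bool → ℕ)) :=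
    {A | A ∈ V ∧ DependsOn (fun x => x ∈ A) {k | k.1 < ξ}}
  let F₁ := F ⊓ generate S₁
  have hF₁ : F₁.NeBot := V.neBot.mono (le_inf hV (le_generate_iff.2 fun A hA => hA.1))
  have upd_eq : ∀ {η}, ξ ≤ η → ∀ {A : Set (W × Bool → ℕ)},
      DependsOn (fun x => x ∈ A) {k | k.1 < ξ} →
      ∀ i n, (fun x => Function.update x (η, i) n) ⁻¹' A = A := by
    intro η hη A hA i n
    ext x
    refine iff_of_eq (hA fun k hk => ?_)
    have : k ≠ (η, i) := by rintro rfl; exact absurd hk (not_lt.2 hη)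
    simp [this]
  have inv₁ : ∀ η, ξ ≤ η → ∀ m ∈ coordUpdates η, Tendsto m F₁ F₁ := by
    rintro η hη m ⟨i, n, rfl⟩
    refine tendsto_inf_generate (inv η hη _ ⟨i, n, rfl⟩) ?_
    intro A hA
    rw [upd_eq hη hA.2]
    exact mem_inf_generate hA
  let S₂ : Set (Set (W × Bool → ℕ)) := {T | ∃ n, T = {x | n < x (ξ, false)}} ∪
    {T | ∃ P : ℕ → Set (W × Bool → ℕ), (∀ n, DependsOn (fun x => x ∈ P n) {k | k.1 < ξ}) ∧
      (∀ n, P n ∉ V) ∧ T = {x | ∀ m < x (ξ, false), x ∉ P m}}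
  refine ⟨F₁ ⊓ generate S₂, inf_le_left.trans inf_le_left, inf_generate_neBot ?_, ?_, ?_, ?_⟩
  · intro R hR t htS htf
    -- Any large enough standard value can be prescribed at `(ξ, false)`.
    have key : ∀ T ∈ t, ∀ᶠ N in atTop, ∀ᶠ x in F₁, Function.update x (ξ, false) N ∈ T := by
      intro T hT
      rcases htS hT with ⟨n, rfl⟩ | ⟨P, hP, hPV, rfl⟩
      · filter_upwards [eventually_gt_atTop n] with N hN
        simp [hN]
      · refine Eventually.of_forall fun N => ?_
        have : ∀ᶠ x in F₁, ∀ m ∈ Set.Iio N, x ∈ (P m)ᶜ := by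
          rw [eventually_all_finite (Set.finite_Iio N)]
          intro m _
          refine mem_inf_generate ⟨Ultrafilter.compl_mem_iff_notMem.2 (hPV m), ?_⟩
          intro x y hxy
          exact congrArg Not (hP m hxy)
        filter_upwards [this] with x hx
        simp only [Function.update_self]
        intro m hm h
        have h' : x ∈ (fun x => Function.update x (ξ, false) N) ⁻¹' P m := h
        rw [upd_eq le_rfl (hP m)] at h'
        exact hx m hm h'
    obtain ⟨N, hN⟩ := ((eventually_all_finite htf).2 key).exists
    have hN' := (eventually_all_finite htf).2 hN
    obtain ⟨x, hx, hxR⟩ := (hN'.and ((inv₁ ξ le_rfl _ ⟨false, N, rfl⟩) hR)).exists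
    exact ⟨_, hxR, hx⟩
  · rintro η hη m ⟨i, n, rfl⟩
    refine tendsto_inf_generate (inv₁ η hη.le _ ⟨i, n, rfl⟩) ?_
    intro T hT
    convert mem_inf_generate hT using 1
    have hne : ((ξ, false) : W × Bool) ≠ (η, i) := fun h => hη.ne (congrArg Prod.fst h)
    rcases hT with ⟨l, rfl⟩ | ⟨P, hP, hPV, rfl⟩
    · ext x
      simp [hne]
    · ext x
      simp only [Set.mem_preimage, Set.mem_ofPred_eq, Function.update_of_ne hne]
      refine forall₂_congr fun j _ => not_congr ?_
      change x ∈ (fun x => Function.update x (η, i) n) ⁻¹' P j ↔ _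
      rw [upd_eq hη.le (hP j)]
  · intro n
    exact mem_inf_generate (Or.inl ⟨n, rfl⟩)
  · intro P hP
    by_cases h : ∃ n, P n ∈ V
    · obtain ⟨n, hn⟩ := h
      exact Or.inl ⟨n, mem_inf_of_left (mem_inf_generate ⟨hn, hP n⟩)⟩
    · push Not at h
      exact Or.inr (mem_inf_generate (Or.inr ⟨P, hP, h, rfl⟩))

/-- The generic ultrafilter: along `L` it adds pairs of distinct numbers that are indistinguishable
by sets with support below them and outside `L`; outside `L` it adds a descending sequence of
infinite numbers, each below all infinite numbers that are supported earlier. -/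
theorem exists_generic_ultrafilter [WellFoundedLT W] (L : Set W)
    (hL : ∀ a ∈ L, ∀ w, w ∉ L → a < w) :
    ∃ U : Ultrafilter (W × Bool → ℕ), ↑U ≤ denseInterior (W × Bool → ℕ) ∧
      (∀ α ∈ L, {x | x (α, false) ≠ x (α, true)} ∈ U ∧
        ∀ Y : ℕ → Set (W × Bool → ℕ),
          (∀ n, DependsOn (fun x => x ∈ Y n) {k | k.1 < α ∨ k.1 ∉ L}) →
          {x | x ∈ Y (x (α, false)) ↔ x ∈ Y (x (α, true))} ∈ U) ∧
      ∀ ξ, ξ ∉ L → (∀ n, {x | n < x (ξ, false)} ∈ U) ∧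
        ∀ P : ℕ → Set (W × Bool → ℕ), (∀ n, DependsOn (fun x => x ∈ P n) {k | k.1 < ξ}) →
          (∃ n, P n ∈ U) ∨ {x | ∀ m < x (ξ, false), x ∉ P m} ∈ U := by
  let Good : W → Filter (W × Bool → ℕ) → Prop := fun w F =>
    (w ∈ L → {x | x (w, false) ≠ x (w, true)} ∈ F ∧
        ∀ Y : ℕ → Set (W × Bool → ℕ),
          (∀ n, DependsOn (fun x => x ∈ Y n) {k | k.1 < w ∨ k.1 ∉ L}) →
          {x | x ∈ Y (x (w, false)) ↔ x ∈ Y (x (w, true))} ∈ F) ∧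
    (w ∉ L → (∀ n, {x | n < x (w, false)} ∈ F) ∧
        ∀ P : ℕ → Set (W × Bool → ℕ), (∀ n, DependsOn (fun x => x ∈ P n) {k | k.1 < w}) →
          (∃ n, P n ∈ F) ∨ {x | ∀ m < x (w, false), x ∉ P m} ∈ F)
  have mono : ∀ w F F', F' ≤ F → Good w F → Good w F' := by
    rintro w F F' hle ⟨h1, h2⟩
    exact ⟨fun hw => ⟨hle (h1 hw).1, fun Y hY => hle ((h1 hw).2 Y hY)⟩,
      fun hw => ⟨fun n => hle ((h2 hw).1 n), fun P hP =>
        ((h2 hw).2 P hP).imp (fun ⟨n, hn⟩ => ⟨n, hle hn⟩) fun h => hle h⟩⟩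
  obtain ⟨F, hF, hne, hgood⟩ := exists_filter_of_forall_step coordUpdates Good mono
    (denseInterior (W × Bool → ℕ))
    (by rintro η m ⟨i, n, rfl⟩; exact tendsto_update_denseInterior _ _)
    (by
      intro w F hne _ inv
      by_cases hw : w ∈ L
      · obtain ⟨F', h1, h2, h3, h4, h5⟩ := exists_filter_symmetric L (hL w hw) hne inv
        exact ⟨F', h1, h2, h3, fun _ => ⟨h4, h5⟩, fun h => absurd hw h⟩
      · obtain ⟨F', h1, h2, h3, h4, h5⟩ := exists_filter_infinitesimal hne inv
        exact ⟨F', h1, h2, h3, fun h => absurd h hw, fun _ => ⟨h4, h5⟩⟩)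
  have hU := Ultrafilter.of_le F
  exact ⟨Ultrafilter.of F, hU.trans hF, fun α hα => (mono α _ _ hU (hgood α)).1 hα,
    fun ξ hξ => (mono ξ _ _ hU (hgood ξ)).2 hξ⟩

end Generic

/-! ### Independent functions modulo a regular filter -/

/-- A family of functions from `I` to `ℕ`, indexed by `K` and bundled as `G : I → K → ℕ`, is
independent modulo the filter `D` if any finitely many of its members take any prescribed values
simultaneously on a `D`-positive set. -/
def IndepMod {I K : Type*} (G : I → K → ℕ) (D : Filter I) : Prop :=
  ∀ (Q : Finset K) (x : K → ℕ), ∃ᶠ t in D, ∀ k ∈ Q, G t k = x k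

/-- The independent family of Engelking and Karłowicz: identify `I` with the pairs `(F, h)` of a
finite set `F ⊆ I` and a finitely supported `h : Finset I → ℕ`, and map `(F, h)` to `h (F ∩ S)` for
`S ⊆ I`. It is independent modulo the filter generated by the regularizing sets `{(F, h) | i ∈ F}`,
because a large `F` tells finitely many given `S` apart. -/
theorem exists_isRegular_indepMod {I K : Type u} [Infinite I] {e : K → Set I}
    (he : Function.Injective e) :
    ∃ (G : I → K → ℕ) (D : Filter I), IsRegular D ∧ IndepMod G D := by
  classical
  have hcard : Cardinal.mk (Finset I × (Finset I →₀ ℕ)) = Cardinal.mk I := by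
    have h1 : Cardinal.mk (Finset I →₀ ℕ) = Cardinal.mk I := by
      simp
    rw [Cardinal.mk_prod, h1]
    simp
  obtain ⟨φ⟩ := Cardinal.eq.1 hcard.symm
  let X : I → Set I := fun i => {t | i ∈ (φ t).1}
  let G : I → K → ℕ := fun t k => (φ t).2 ((φ t).1.filter (· ∈ e k))
  refine ⟨G, generate (Set.range X), ⟨X, fun i => .basic ⟨i, rfl⟩, ?_⟩, ?_⟩
  · intro σ hσ
    rw [Set.eq_empty_iff_forall_notMem]
    intro t ht
    refine hσ ((φ t).1.finite_toSet.subset fun i hi => ?_)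
    exact Set.mem_iInter₂.1 ht i hi
  · intro Q x
    rw [frequently_iff]
    intro R hR
    obtain ⟨T, hT, hTf, hTR⟩ := mem_generate_iff.1 hR
    obtain ⟨F₀, hF₀⟩ : ∃ F₀ : Finset I, ∀ t, F₀ ⊆ (φ t).1 → t ∈ R := by
      have hT' : ∀ A ∈ T, ∃ i, X i = A := fun A hA => hT hA
      choose! f hf using hT'
      refine ⟨hTf.toFinset.image f, fun t ht => hTR fun A hA => ?_⟩
      rw [← hf A hA]
      exact ht (Finset.mem_image_of_mem f (hTf.mem_toFinset.2 hA))
    have hsep : ∀ k k', ∃ i, k ≠ k' → ¬ (i ∈ e k ↔ i ∈ e k') := by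
      intro k k'
      by_cases h : k = k'
      · exact ⟨Classical.arbitrary I, fun h' => absurd h h'⟩
      · by_contra! hc
        exact h (he (Set.ext fun i => (hc i).2))
    -- `d k k'` lies in exactly one of `e k` and `e k'`.
    choose d hd using hsep
    let F : Finset I := F₀ ∪ (Q ×ˢ Q).image fun p => d p.1 p.2
    let tr : K → Finset I := fun k => F.filter (· ∈ e k)
    have htr : ∀ k ∈ Q, ∀ k' ∈ Q, tr k = tr k' → k = k' := by
      intro k hk k' hk' h
      by_contra hne
      refine hd k k' hne ?_
      have hmem : d k k' ∈ F := Finset.mem_union_right _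
        (Finset.mem_image.2 ⟨(k, k'), Finset.mk_mem_product hk hk', rfl⟩)
      have := Finset.ext_iff.1 h (d k k')
      simpa [tr, hmem] using this
    let h : Finset I →₀ ℕ := ∑ k ∈ Q, Finsupp.single (tr k) (x k)
    refine ⟨φ.symm (F, h), hF₀ _ (by simp [F]), fun k hk => ?_⟩
    have : G (φ.symm (F, h)) k = h (tr k) := by simp [G, tr]
    rw [this]
    simp only [h, Finsupp.finsetSum_apply]
    rw [Finset.sum_eq_single_of_mem k hk]
    · simp
    · intro k' hk' hne
      exact Finsupp.single_eq_of_ne fun hEq => hne (htr _ hk' _ hk hEq.symm)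

section Forced

variable {I K : Type*} {G : I → K → ℕ} {D : Filter I}

/-- A filter modulo which `G` is independent extends to a maximal one. -/
theorem IndepMod.exists_maximal (h : IndepMod G D) :
    ∃ D' ≤ D, IndepMod G D' ∧ ∀ D'' ≤ D', IndepMod G D'' → D' ≤ D'' := by
  obtain ⟨m, hm, hmax⟩ := zorn_le_nonempty₀ (α := (Filter I)ᵒᵈ)
    {F | IndepMod G (OrderDual.ofDual F)} (fun c hc hchain y hy => by
      have : Nonempty c := ⟨⟨y, hy⟩⟩
      refine ⟨OrderDual.toDual (⨅ F : c, OrderDual.ofDual F.1), ?_, fun z hz =>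
        iInf_le (fun F : c => OrderDual.ofDual F.1) ⟨z, hz⟩⟩
      intro Q x
      change ∃ᶠ t in ⨅ F : c, OrderDual.ofDual F.1, _
      rw [frequently_iff]
      intro R hR
      rw [mem_iInf_of_directed] at hR
      · obtain ⟨F, hF⟩ := hR
        exact frequently_iff.1 (hc F.2 Q x) hF
      · intro a b
        rcases hchain.total a.2 b.2 with hab | hab
        · exact ⟨b, hab, le_rfl⟩
        · exact ⟨a, le_rfl, hab⟩) (OrderDual.toDual D) h
  exact ⟨OrderDual.ofDual m, hm, hmax.1, fun D'' hle hD'' => hmax.2 hD'' hle⟩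

/-! ### Maximal filters and the regular open algebra -/

/-- The cylinder of all `x : K → ℕ` that agree with the finite set `c` of prescribed values. -/
def cyl (c : Finset (K × ℕ)) : Set (K → ℕ) := {x | ∀ p ∈ c, x p.1 = p.2}

theorem isOpen_cyl (c : Finset (K × ℕ)) : IsOpen (cyl c) := by
  have : cyl c = ⋂ p ∈ c, {x | x p.1 = p.2} := by ext; simp [cyl]
  rw [this]
  exact isOpen_biInter_finset fun p _ => isOpen_setOf_apply_eq p.1 p.2

theorem mem_cyl_union [DecidableEq (K × ℕ)] {c c' : Finset (K × ℕ)} {x : K → ℕ} :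
    x ∈ cyl (c ∪ c') ↔ x ∈ cyl c ∧ x ∈ cyl c' := by
  simp only [cyl, Set.mem_ofPred_eq, Finset.mem_union, or_imp, forall_and]

theorem IndepMod.frequently_mem_cyl (h : IndepMod G D) {c : Finset (K × ℕ)} {x : K → ℕ}
    (hx : x ∈ cyl c) : ∃ᶠ t in D, G t ∈ cyl c := by
  classical
  refine (h (c.image Prod.fst) x).mono fun t ht p hp => ?_
  rw [ht p.1 (Finset.mem_image_of_mem _ hp), hx p hp]

/-- The union of the cylinders whose preimage under `G` is contained in `A` modulo `D`. If `D` is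
maximal among the filters modulo which `G` is independent, then `forced G D` identifies the
Boolean algebra of subsets of `I` modulo `D` with the regular open algebra of `K → ℕ`. -/
def forced (G : I → K → ℕ) (D : Filter I) (A : Set I) : Set (K → ℕ) :=
  {x | ∃ c, x ∈ cyl c ∧ ∀ᶠ t in D, G t ∈ cyl c → t ∈ A}

theorem forced_mono {A B : Set I} (h : A ⊆ B) : forced G D A ⊆ forced G D B :=
  fun _ ⟨c, hx, hc⟩ => ⟨c, hx, hc.mono fun _ ht hG => h (ht hG)⟩

theorem forced_inter_subset (A B : Set I) :
    forced G D A ∩ forced G D B ⊆ forced G D (A ∩ B) := by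
  classical
  rintro x ⟨⟨c, hx, hc⟩, ⟨c', hx', hc'⟩⟩
  refine ⟨c ∪ c', mem_cyl_union.2 ⟨hx, hx'⟩, ?_⟩
  filter_upwards [hc, hc'] with t h1 h2 hG
  exact ⟨h1 (mem_cyl_union.1 hG).1, h2 (mem_cyl_union.1 hG).2⟩

theorem forced_eq_univ {A : Set I} (hA : A ∈ D) : forced G D A = Set.univ :=
  Set.eq_univ_of_forall fun x => ⟨∅, by simp [cyl], mem_of_superset hA fun _ h _ => h⟩

theorem mem_forced_setOf_apply_eq (x : K → ℕ) (k : K) : x ∈ forced G D {t | G t k = x k} :=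
  ⟨{(k, x k)}, by simp [cyl], Eventually.of_forall fun t h => by simpa [cyl] using h⟩

theorem IndepMod.forced_empty (h : IndepMod G D) : forced G D ∅ = ∅ := by
  rw [Set.eq_empty_iff_forall_notMem]
  rintro x ⟨c, hx, hc⟩
  obtain ⟨t, h1, h2⟩ := ((h.frequently_mem_cyl hx).and_eventually hc).exists
  exact h2 h1

/-- For maximal `D`, every finite condition can be strengthened to one that decides `A`. -/
theorem IndepMod.exists_decides (h : IndepMod G D)
    (hmax : ∀ D' ≤ D, IndepMod G D' → D ≤ D') (A : Set I) (c : Finset (K × ℕ)) :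
    ∃ c' ⊇ c, ((cyl c).Nonempty → (cyl c').Nonempty) ∧
      ((∀ᶠ t in D, G t ∈ cyl c' → t ∈ A) ∨ ∀ᶠ t in D, G t ∈ cyl c' → t ∈ Aᶜ) := by
  classical
  by_contra! hcon
  have hfreq : ∀ c' ⊇ c, (cyl c').Nonempty → ∃ᶠ t in D, G t ∈ cyl c' ∧ t ∈ A := by
    intro c' hc' hne
    have := (hcon c' hc' fun _ => hne).2
    simpa only [Filter.not_eventually, Classical.not_imp, Set.mem_compl_iff, not_not] using this
  -- If no extension of `c` forces `Aᶜ`, then adding to `D` that `c` forces `A` keeps `G` independent.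
  have hle : D ≤ D ⊓ 𝓟 {t | G t ∈ cyl c → t ∈ A} := by
    refine hmax _ inf_le_left fun Q x => ?_
    rw [frequently_inf_principal]
    by_cases hx : x ∈ cyl c
    · have hx' : x ∈ cyl (c ∪ Q.image fun k => (k, x k)) := by
        rw [mem_cyl_union]
        exact ⟨hx, by simp [cyl]⟩
      refine (hfreq _ Finset.subset_union_left ⟨x, hx'⟩).mono ?_
      rintro t ⟨h1, h2⟩
      refine ⟨fun _ => h2, fun k hk => ?_⟩
      exact (mem_cyl_union.1 h1).2 (k, x k) (Finset.mem_image_of_mem _ hk)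
    · obtain ⟨p, hp, hne⟩ : ∃ p ∈ c, x p.1 ≠ p.2 := by simpa [cyl] using hx
      refine (h (insert p.1 Q) x).mono fun t ht => ⟨fun hG => ?_, fun k hk =>
        ht k (Finset.mem_insert_of_mem hk)⟩
      exact absurd ((ht _ (Finset.mem_insert_self _ _)).symm.trans (hG p hp)) hne
  refine (hcon c subset_rfl id).1 ?_
  filter_upwards [le_principal_iff.1 (hle.trans inf_le_right)] with t ht h'
  exact h'.2 (ht h'.1)

/-- A countable set of indices closed under a function on finite conditions. -/
theorem exists_countable_closed (r : Finset (K × ℕ) → Finset (K × ℕ)) :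
    ∃ s : Set K, s.Countable ∧
      ∀ c : Finset (K × ℕ), (∀ p ∈ c, p.1 ∈ s) → ∀ p ∈ r c, p.1 ∈ s := by
  classical
  let nxt : Set K → Set K := fun s =>
    s ∪ ⋃ c ∈ {c : Finset (K × ℕ) | ∀ p ∈ c, p.1 ∈ s}, Prod.fst '' (r c : Set (K × ℕ))
  let s : ℕ → Set K := fun n => nxt^[n] ∅
  have hs : ∀ n, s (n + 1) = nxt (s n) := fun n => Function.iterate_succ_apply' _ _ _
  have hmono : Monotone s := monotone_nat_of_le_succ fun n => by
    rw [hs]; exact Set.subset_union_left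
  have hcount : ∀ n, (s n).Countable := by
    intro n
    induction n with
    | zero => exact Set.countable_empty
    | succ n ih =>
      rw [hs]
      refine ih.union (Set.Countable.biUnion ?_ fun c _ =>
        ((r c).finite_toSet.image Prod.fst).countable)
      have := (Set.countable_ofPred_finite_subset
        (ih.prod (Set.countable_univ (α := ℕ)))).preimage
          (Finset.coe_injective (α := K × ℕ))
      refine this.mono fun c hc => ?_
      exact Set.mem_preimage.2 ⟨c.finite_toSet, fun p hp => ⟨hc p hp, trivial⟩⟩
  refine ⟨⋃ n, s n, Set.countable_iUnion hcount, fun c hc p hp => ?_⟩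
  obtain ⟨n, hn⟩ : ∃ n, ∀ p ∈ c, p.1 ∈ s n := by
    have hev : ∀ p ∈ c, ∀ᶠ n in atTop, p.1 ∈ s n := fun p hp => by
      obtain ⟨n, hn⟩ := Set.mem_iUnion.1 (hc p hp)
      exact (eventually_ge_atTop n).mono fun m hm => hmono hm hn
    exact ((Filter.eventually_all_finset c).2 hev).exists
  refine Set.mem_iUnion.2 ⟨n + 1, ?_⟩
  rw [hs]
  exact Or.inr (Set.mem_iUnion₂.2 ⟨c, hn, p, hp, rfl⟩)

/-- For maximal `D`, a set `A` is decided modulo `D` by countably many coordinates: choose an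
extension deciding `A` for every finite condition, and close under this choice. -/
theorem IndepMod.exists_countable_support (h : IndepMod G D)
    (hmax : ∀ D' ≤ D, IndepMod G D' → D ≤ D') (A : Set I) :
    ∃ (s : Set K) (P P' : Set (K → ℕ)), s.Countable ∧ DependsOn (fun x => x ∈ P) s ∧
      P ⊆ forced G D A ∧ P' ⊆ forced G D Aᶜ ∧ P ∪ P' ∈ denseInterior (K → ℕ) := by
  classical
  choose r hr hne hdec using h.exists_decides hmax A
  obtain ⟨s, hs, hclosed⟩ := exists_countable_closed r
  let O : Set I → Set (K → ℕ) := fun B =>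
    ⋃ c ∈ {c : Finset (K × ℕ) | (∀ p ∈ c, p.1 ∈ s) ∧ ∀ᶠ t in D, G t ∈ cyl c → t ∈ B}, cyl c
  have hO : ∀ B, O B ⊆ forced G D B := by
    intro B x hx
    obtain ⟨c, hc, hx⟩ := Set.mem_iUnion₂.1 hx
    exact ⟨c, hx, hc.2⟩
  have hopen : ∀ B, IsOpen (O B) := fun B => isOpen_biUnion fun c _ => isOpen_cyl c
  refine ⟨s, O A, O Aᶜ, hs, ?_, hO A, hO Aᶜ, ?_⟩
  · intro x y hxy
    simp only [O, Set.mem_iUnion, exists_prop, eq_iff_iff]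
    refine exists_congr fun c => and_congr_right fun hc => forall₂_congr fun p hp => ?_
    rw [hxy _ (hc.1 p hp)]
  · rw [mem_denseInterior, ((hopen _).union (hopen _)).interior_eq, dense_iff_inter_open]
    rintro V hV ⟨x, hx⟩
    obtain ⟨Q, u, hu, hQV⟩ := isOpen_pi_iff.1 hV x hx
    let c : Finset (K × ℕ) := (Q.filter (· ∈ s)).image fun k => (k, x k)
    have hxc : x ∈ cyl c := by
      intro p hp
      obtain ⟨k, -, rfl⟩ := Finset.mem_image.1 hp
      rfl
    have hcs : ∀ p ∈ c, p.1 ∈ s := by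
      intro p hp
      obtain ⟨k, hk, rfl⟩ := Finset.mem_image.1 hp
      exact (Finset.mem_filter.1 hk).2
    obtain ⟨y, hy⟩ := hne c ⟨x, hxc⟩
    -- The condition `r c` mentions only indices in `s`, so outside `s` the values of `x` can be kept.
    let z : K → ℕ := fun k => if k ∈ s then y k else x k
    have hz : z ∈ cyl (r c) := by
      intro p hp
      simp only [z, if_pos (hclosed c hcs p hp)]
      exact hy p hp
    refine ⟨z, hQV fun k hk => ?_, ?_⟩
    · have : z k = x k := by
        by_cases hks : k ∈ s
        · simp only [z, if_pos hks]
          exact hy (k, x k) (hr c (Finset.mem_image_of_mem _ (Finset.mem_filter.2 ⟨hk, hks⟩)))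
        · simp only [z, if_neg hks]
      rw [this]
      exact (hu k hk).2
    · rcases hdec c with hd | hd
      · exact Or.inl (Set.mem_iUnion₂.2 ⟨r c, ⟨hclosed c hcs, hd⟩, hz⟩)
      · exact Or.inr (Set.mem_iUnion₂.2 ⟨r c, ⟨hclosed c hcs, hd⟩, hz⟩)

theorem IndepMod.exists_countable_support_seq (h : IndepMod G D)
    (hmax : ∀ D' ≤ D, IndepMod G D' → D ≤ D') (A : ℕ → Set I) :
    ∃ (s : Set K) (P P' : ℕ → Set (K → ℕ)), s.Countable ∧ ∀ n, DependsOn (fun x => x ∈ P n) s ∧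
      P n ⊆ forced G D (A n) ∧ P' n ⊆ forced G D (A n)ᶜ ∧
      P n ∪ P' n ∈ denseInterior (K → ℕ) := by
  choose s P P' hs hP h1 using fun n => h.exists_countable_support hmax (A n)
  exact ⟨⋃ n, s n, P, P', Set.countable_iUnion hs, fun n =>
    ⟨(hP n).mono (Set.subset_iUnion s n), h1 n⟩⟩

/-- For maximal `D`, an ultrafilter on `K → ℕ` that contains all sets with dense interior induces
an ultrafilter on `I` extending `D`. -/
theorem IndepMod.exists_ultrafilter (h : IndepMod G D)
    (hmax : ∀ D' ≤ D, IndepMod G D' → D ≤ D') {U : Ultrafilter (K → ℕ)}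
    (hU : ↑U ≤ denseInterior (K → ℕ)) :
    ∃ E : Ultrafilter I, ↑E ≤ D ∧ ∀ A, A ∈ E ↔ forced G D A ∈ U := by
  let F : Filter I :=
    { sets := {A | forced G D A ∈ U}
      univ_sets := by
        rw [Set.mem_ofPred_eq, forced_eq_univ univ_mem]
        exact univ_mem
      sets_of_superset := fun hA hAB => mem_of_superset hA (forced_mono hAB)
      inter_sets := fun hA hB => mem_of_superset (inter_mem hA hB) (forced_inter_subset _ _) }
  have hF : ∀ A, A ∈ F ↔ forced G D A ∈ U := fun A => Iff.rfl
  refine ⟨Ultrafilter.ofComplNotMemIff F fun A => ?_, fun A hA => ?_, hF⟩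
  · rw [hF, hF]
    constructor
    · intro hA
      obtain ⟨s, P, P', -, -, hP, hP', hd⟩ := h.exists_countable_support hmax A
      have hor : P ∪ P' ∈ U := hU hd
      rcases Ultrafilter.union_mem_iff.1 hor with h1 | h1
      · exact mem_of_superset h1 hP
      · exact absurd (mem_of_superset h1 hP') hA
    · intro hA hA'
      have := mem_of_superset (inter_mem hA hA') (forced_inter_subset A Aᶜ)
      rw [Set.inter_compl_self, h.forced_empty] at this
      exact U.empty_notMem this
  · change forced G D A ∈ U
    rw [forced_eq_univ hA]
    exact univ_mem

end Forced

/-! ### The random graph and internal separation -/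

/-- The extension property of a simple graph: any two disjoint finite sets of vertices are
separated by the neighbourhood of a further vertex. -/
def ExtensionProperty {V : Type*} (G : SimpleGraph V) : Prop :=
  ∀ A B : Finset V, Disjoint A B → ∃ z, z ∉ A ∧ z ∉ B ∧ (∀ a ∈ A, G.Adj z a) ∧ ∀ b ∈ B, ¬G.Adj z b

/-- The Rado graph on `ℕ` (lifted to an arbitrary universe): two numbers are adjacent if the
smaller one is the position of a binary digit `1` of the larger one. -/
def radoGraph : SimpleGraph (ULift.{u} ℕ) :=
  SimpleGraph.fromRel fun x y => x.down.testBit y.down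

theorem extensionProperty_radoGraph : ExtensionProperty radoGraph.{u} := by
  classical
  intro A B hAB
  obtain ⟨N, hN⟩ : ∃ N, ∀ v ∈ A ∪ B, v.down < N := by
    refine ⟨(A ∪ B).sup ULift.down + 1, fun v hv => ?_⟩
    exact Nat.lt_succ_of_le (Finset.le_sup (f := ULift.down) hv)
  -- The digit `1` at position `N` makes `z` larger than all of `A` and `B`.
  let z : ℕ := Nat.ofBits fun i : Fin (N + 1) => decide ((⟨i⟩ : ULift ℕ) ∈ A ∨ (i : ℕ) = N)
  have hbit : ∀ i ≤ N, z.testBit i = decide ((⟨i⟩ : ULift ℕ) ∈ A ∨ i = N) := fun i hi =>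
    Nat.testBit_ofBits_lt _ i (Nat.lt_succ_of_le hi)
  have hz : N < z := by
    have : z.testBit N = true := by rw [hbit N le_rfl]; simp
    exact Nat.lt_two_pow_self.trans_le (Nat.ge_two_pow_of_testBit this)
  have hlt : ∀ v ∈ A ∪ B, v.down < z := fun v hv => (hN v hv).trans hz
  have hadj : ∀ v ∈ A ∪ B, (radoGraph.Adj ⟨z⟩ v ↔ v ∈ A) := by
    intro v hv
    have h1 : v.down.testBit z = false :=
      Nat.testBit_lt_two_pow ((hlt v hv).trans Nat.lt_two_pow_self)
    have h2 : (⟨z⟩ : ULift ℕ) ≠ v := fun h => (hlt v hv).ne (congrArg ULift.down h).symm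
    have h3 : v.down ≠ N := (hN v hv).ne
    rw [radoGraph, SimpleGraph.fromRel_adj]
    simp [h1, h2, h3, hbit v.down (hN v hv).le]
  have hmem : ∀ v ∈ A ∪ B, (⟨z⟩ : ULift ℕ) ≠ v := fun v hv h =>
    (hlt v hv).ne (congrArg ULift.down h).symm
  refine ⟨⟨z⟩, fun h => hmem _ (Finset.mem_union_left _ h) rfl,
    fun h => hmem _ (Finset.mem_union_right _ h) rfl, fun a ha => ?_, fun b hb h => ?_⟩
  · exact (hadj a (Finset.mem_union_left _ ha)).2 ha
  · exact Finset.disjoint_left.1 hAB ((hadj b (Finset.mem_union_right _ hb)).1 h) hb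

theorem ExtensionProperty.model {V : Type*} {G : SimpleGraph V} (h : ExtensionProperty G) :
    letI := G.structure
    V ⊨ randomGraphTheory := by
  classical
  let := G.structure
  rw [randomGraphTheory, Theory.model_union_iff]
  refine ⟨inferInstance, ⟨?_⟩⟩
  rintro φ ⟨m, n, rfl⟩
  rw [extensionAxiom]
  change Formula.Realize _ _
  rw [Formula.realize_iAlls]
  intro x
  rw [Formula.realize_imp]
  intro hx
  have hx' : ∀ (i : Fin m) (j : Fin n), x (Sum.inl i) ≠ x (Sum.inr j) := by
    intro i j
    have := (BoundedFormula.realize_iInf.1 hx) (i, j)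
    simpa [Formula.Realize, Term.equal] using this
  obtain ⟨z, hzA, hzB, hA, hB⟩ := h (Finset.univ.image fun i => x (Sum.inl i))
    (Finset.univ.image fun j => x (Sum.inr j)) (by
      rw [Finset.disjoint_left]
      simp only [Finset.mem_image, Finset.mem_univ, true_and]
      rintro _ ⟨i, rfl⟩ ⟨j, hj⟩
      exact hx' i j hj.symm)
  rw [Formula.realize_iExs]
  refine ⟨fun _ => z, ?_⟩
  have hz : ∀ v, z ≠ x v := by
    rintro (i | j) rfl
    · simp at hzA
    · simp at hzB
  refine BoundedFormula.realize_inf.2 ⟨BoundedFormula.realize_iInf.2 fun v => ?_,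
    BoundedFormula.realize_inf.2 ⟨BoundedFormula.realize_iInf.2 fun i => ?_,
      BoundedFormula.realize_iInf.2 fun j => ?_⟩⟩
  · simpa [Term.equal] using hz v
  · exact Formula.realize_rel₂.2 (hA _ (by simp))
  · exact fun hc => hB _ (by simp) (Formula.realize_rel₂.1 hc)

section Ultrapower

variable {I : Type u} {D : Ultrafilter I} {V : Type u}

/-- The element of the ultrapower represented by `x`. -/
def toProduct (D : Ultrafilter I) (x : I → V) : (D : Filter I).Product fun _ => V :=
  Quotient.mk'' x

theorem relMap_adj_toProduct_iff (G : SimpleGraph V) (x y : I → V) :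
    letI := G.structure
    Structure.RelMap adj ![toProduct D x, toProduct D y] ↔ ∀ᶠ t in D, G.Adj (x t) (y t) := by
  let := G.structure
  have := @relMap_quotient_mk' Language.graph _ ((D : Filter I).productSetoid fun _ => V)
    (Ultraproduct.setoidPrestructure (fun _ => V) D) 2 adj ![x, y]
  convert! this using 2
  ext i
  fin_cases i <;> rfl

/-- If `D` saturates the theory of the random graph, then any two families of at most `|I|`
elements of `ℕ^I / D`, the members of the one being distinct from those of the other, are
separated by an internal set `∏ t, Y t / D`. -/
theorem Saturates.exists_separation (h : Saturates D randomGraphTheory) {ι : Type u}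
    (hι : Cardinal.mk (ι × Bool) ≤ Cardinal.mk I) (v : ι × Bool → I → ℕ)
    (hv : ∀ α β, ∀ᶠ t in D, v (α, true) t ≠ v (β, false) t) :
    ∃ Y : I → Set ℕ, ∀ α, (∀ᶠ t in D, v (α, true) t ∈ Y t) ∧ ∀ᶠ t in D, v (α, false) t ∉ Y t := by
  classical
  let := radoGraph.{u}.structure
  let w : ι × Bool → (D : Filter I).Product fun _ => ULift.{u} ℕ := fun k =>
    toProduct D fun t => ULift.up (v k t)
  let A : Set ((D : Filter I).Product fun _ => ULift.{u} ℕ) := Set.range w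
  -- The type says that the vertex sought is adjacent to `w k` exactly if `k.2` is `true`.
  let ψ : ι × Bool → (Language.graph[[A]]).Formula Unit := fun k =>
    Relations.formula₂ (Sum.inl adj : (Language.graph[[A]]).Relations 2) (Term.var ())
      (Language.graph.con (⟨w k, k, rfl⟩ : A)).term
  let θ : ι × Bool → (Language.graph[[A]]).Formula Unit := fun k =>
    if k.2 then ψ k else (ψ k).not
  have hψ : ∀ k (z : I → ULift ℕ), (ψ k).Realize (fun _ => toProduct D z) ↔
      ∀ᶠ t in D, radoGraph.Adj (z t) ⟨v k t⟩ := by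
    intro k z
    rw [← relMap_adj_toProduct_iff]
    exact Formula.realize_rel₂
  have hθ : ∀ k (z : I → ULift ℕ), (θ k).Realize (fun _ => toProduct D z) ↔
      ∀ᶠ t in D, (radoGraph.Adj (z t) ⟨v k t⟩ ↔ k.2 = true) := by
    rintro ⟨α, _ | _⟩ z
    · simp [θ, Formula.realize_not, hψ]
    · simp [θ, hψ]
  obtain ⟨b, hb⟩ := h (ULift.{u} ℕ) extensionProperty_radoGraph.model A
    (Order.lt_succ_of_le ((Cardinal.mk_range_le).trans hι)) (Set.range θ) (by
      intro s hs
      rw [← Set.image_univ, Finset.subset_set_image_iff] at hs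
      obtain ⟨Q, -, rfl⟩ := hs
      have hgood : ∀ᶠ t in D, ∀ k ∈ Q, ∀ k' ∈ Q, k.2 = true → k'.2 = false → v k t ≠ v k' t := by
        rw [Filter.eventually_all_finset]
        intro k _
        rw [Filter.eventually_all_finset]
        intro k' _
        obtain ⟨α, i⟩ := k
        obtain ⟨β, j⟩ := k'
        by_cases hij : i = true ∧ j = false
        · obtain ⟨rfl, rfl⟩ := hij
          exact (hv α β).mono fun t ht _ _ => ht
        · exact Eventually.of_forall fun t h1 h2 => absurd ⟨h1, h2⟩ hij
      have hz : ∀ t, ∃ z : ULift.{u} ℕ,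
          (∀ k ∈ Q, ∀ k' ∈ Q, k.2 = true → k'.2 = false → v k t ≠ v k' t) →
          ∀ k ∈ Q, (radoGraph.Adj z ⟨v k t⟩ ↔ k.2 = true) := by
        intro t
        by_cases ht : ∀ k ∈ Q, ∀ k' ∈ Q, k.2 = true → k'.2 = false → v k t ≠ v k' t
        · obtain ⟨z, -, -, h1, h2⟩ := extensionProperty_radoGraph.{u}
            ((Q.filter fun k => k.2 = true).image fun k => ⟨v k t⟩)
            ((Q.filter fun k => k.2 = false).image fun k => ⟨v k t⟩) (by
              rw [Finset.disjoint_left]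
              simp only [Finset.mem_image, Finset.mem_filter]
              rintro _ ⟨k, ⟨hk, hk1⟩, rfl⟩ ⟨k', ⟨hk', hk1'⟩, e⟩
              exact ht k hk k' hk' hk1 hk1' (congrArg ULift.down e).symm)
          refine ⟨z, fun _ k hk => ?_⟩
          by_cases hk2 : k.2 = true
          · exact iff_of_true (h1 _ (Finset.mem_image_of_mem _ (Finset.mem_filter.2 ⟨hk, hk2⟩))) hk2
          · exact iff_of_false (h2 _ (Finset.mem_image_of_mem _
              (Finset.mem_filter.2 ⟨hk, by simpa using hk2⟩))) hk2
        · exact ⟨⟨0⟩, fun h => absurd h ht⟩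
      choose z hz using hz
      refine ⟨toProduct D z, fun φ hφ => ?_⟩
      obtain ⟨k, hk, rfl⟩ := Finset.mem_image.1 hφ
      rw [hθ]
      exact hgood.mono fun t ht => hz t ht k hk)
  induction b using Quotient.inductionOn' with
  | h z =>
    refine ⟨fun t => {n | radoGraph.Adj (z t) ⟨n⟩}, fun α => ⟨?_, ?_⟩⟩
    · exact ((hθ (α, true) z).1 (hb _ ⟨_, rfl⟩)).mono fun t ht => ht.2 rfl
    · exact ((hθ (α, false) z).1 (hb _ ⟨_, rfl⟩)).mono fun t ht hc => by simpa using ht.1 hc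

end Ultrapower

/-! ### The induced ultrafilter on `I` -/

section Transfer

variable {I K : Type*} {G : I → K → ℕ} {D : Filter I} {U : Ultrafilter (K → ℕ)} {E : Ultrafilter I}

theorem mem_forced_setOf_apply₂ {p : ℕ → ℕ → Prop} {x : K → ℕ} {k k' : K} (h : p (x k) (x k')) :
    x ∈ forced G D {t | p (G t k) (G t k')} := by
  refine forced_mono ?_ (forced_inter_subset _ _
    ⟨mem_forced_setOf_apply_eq x k, mem_forced_setOf_apply_eq x k'⟩)
  rintro t ⟨h1, h2⟩
  simp only [Set.mem_ofPred_eq] at h1 h2 ⊢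
  rwa [h1, h2]

/-- An internal set `∏ t, Y t / E` is decided by countably many coordinates `s`. If the coordinates
at `k` and `k'` belong to the same sets supported on `s`, then the internal set does not separate
the functions with indices `k` and `k'`. -/
theorem not_separated_of_symmetric (hG : IndepMod G D) (hmax : ∀ D' ≤ D, IndepMod G D' → D ≤ D')
    (hU : ↑U ≤ denseInterior (K → ℕ)) (hE : ∀ A, A ∈ E ↔ forced G D A ∈ U) (Y : I → Set ℕ) :
    ∃ s : Set K, s.Countable ∧ ∀ k k' : K,
      (∀ P : ℕ → Set (K → ℕ), (∀ n, DependsOn (fun x => x ∈ P n) s) →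
        {x | x ∈ P (x k') ↔ x ∈ P (x k)} ∈ U) →
      ¬ ((∀ᶠ t in E, G t k ∈ Y t) ∧ ∀ᶠ t in E, G t k' ∉ Y t) := by
  obtain ⟨s, P, P', hs, h⟩ := hG.exists_countable_support_seq hmax fun n => {t | n ∈ Y t}
  choose hP hPf hPf' hd using h
  refine ⟨s, hs, fun k k' hsymm ⟨h1, h2⟩ => ?_⟩
  have hd' := setOf_mem_apply_mem_denseInterior hd
  obtain ⟨x, ⟨⟨hx1, hx2⟩, hxT⟩, hx3⟩ := U.nonempty_of_mem (inter_mem (inter_mem (inter_mem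
    ((hE _).1 h1) ((hE _).1 h2)) (hsymm P hP)) (hU (hd' k)))
  have hempty : ∀ A B C : Set I, x ∈ forced G D A → x ∈ forced G D B → x ∈ forced G D C →
      (∀ t ∈ A, t ∈ B → t ∉ C) → False := by
    intro A B C hA hB hC h
    have := forced_mono (B := ∅) (fun t ht => h t ht.1.1 ht.1.2 ht.2)
      (forced_inter_subset _ _ ⟨forced_inter_subset _ _ ⟨hA, hB⟩, hC⟩)
    rwa [hG.forced_empty] at this
  by_cases hxP : x ∈ P (x k')
  · refine hempty _ _ _ (hPf _ hxP) (mem_forced_setOf_apply_eq x k') hx2 fun t h3 h4 h5 => h5 ?_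
    simp only [Set.mem_ofPred_eq] at h3 h4
    rwa [h4]
  · have hxP' : x ∈ P' (x k) := hx3.resolve_left fun h => hxP (hxT.2 h)
    refine hempty _ _ _ (hPf' _ hxP') (mem_forced_setOf_apply_eq x k) hx1 fun t h3 h4 h5 => h3 ?_
    simp only [Set.mem_ofPred_eq] at h4 h5 ⊢
    rwa [← h4]

/-- A function `f` that is infinite modulo `E` has a countable support `s` such that the function
with index `k` lies strictly below `f`, provided the coordinate at `k` is positive and below all
infinite numbers supported on `s`. -/
theorem eventually_lt_of_infinitesimal (hG : IndepMod G D)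
    (hmax : ∀ D' ≤ D, IndepMod G D' → D ≤ D') (hU : ↑U ≤ denseInterior (K → ℕ))
    (hE : ∀ A, A ∈ E ↔ forced G D A ∈ U) (f : I → ℕ) (hf : ∀ n, ∀ᶠ t in E, n < f t) :
    ∃ s : Set K, s.Countable ∧ ∀ k : K, {x | 0 < x k} ∈ U →
      (∀ P : ℕ → Set (K → ℕ), (∀ n, DependsOn (fun x => x ∈ P n) s) →
        (∃ n, P n ∈ U) ∨ {x | ∀ m < x k, x ∉ P m} ∈ U) →
      ∀ᶠ t in E, G t k < f t := by
  -- The sets below name the predecessor of `f`, which makes the final inequality strict.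
  obtain ⟨s, P, P', hs, h⟩ := hG.exists_countable_support_seq hmax fun n => {t | f t ≤ n + 1}
  choose hP hPf hPf' hd using h
  refine ⟨s, hs, fun k hpos hk => ?_⟩
  rcases hk P hP with ⟨n, hn⟩ | hk
  · have h1 : ∀ᶠ t in E, f t ≤ n + 1 := (hE _).2 (mem_of_superset hn (hPf n))
    obtain ⟨t, h2, h3⟩ := (h1.and (hf (n + 1))).exists
    exact absurd h2 (not_le.2 h3)
  · refine (hE _).2 ?_
    filter_upwards [hk, hpos, hU (setOf_mem_apply_mem_denseInterior (fun n => hd (n - 1)) k)]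
      with x h1 h2 h3
    have h4 : x ∈ P' (x k - 1) := h3.resolve_left (h1 _ (Nat.sub_lt h2 one_pos))
    refine forced_mono ?_ (forced_inter_subset _ _
      ⟨hPf' _ h4, mem_forced_setOf_apply_eq x k⟩)
    rintro t ⟨h5, h6⟩
    simp only [Set.mem_ofPred_eq, Set.mem_compl_iff] at h2 h5 h6 ⊢
    omega

end Transfer

/-- A strict lower bound among the infinite elements, for any `|I|` many infinite elements, makes
the coinitiality larger than `|I|`. -/
theorem succ_le_lcf {I : Type u} {E : Ultrafilter I}
    (h : ∀ (S : Type u) (f : S → I → ℕ), Cardinal.mk S ≤ Cardinal.mk I →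
      (∀ s n, ∀ᶠ t in E, n < f s t) →
      ∃ g : I → ℕ, (∀ n, ∀ᶠ t in E, n < g t) ∧ ∀ s, ∀ᶠ t in E, g t < f s t) :
    Order.succ (Cardinal.mk I) ≤ lcf E := by
  rw [lcf, Order.le_cof_iff]
  intro S hS
  by_contra hcard
  have hcard' : Cardinal.mk S ≤ Cardinal.mk I := Order.lt_succ_iff.1 (not_le.1 hcard)
  have hrep : ∀ s : S, ∃ f : I → ℕ, (f : (E : Filter I).Germ ℕ) = (OrderDual.ofDual s.1).1 :=
    fun s => Quotient.exists_rep _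
  choose f hf using hrep
  obtain ⟨g, hg, hgf⟩ := h S f hcard' fun s n => by
    have := (OrderDual.ofDual s.1).2 n
    rw [← hf s] at this
    exact Filter.Germ.coe_lt.1 this
  obtain ⟨s, hs, hle⟩ := hS (OrderDual.toDual ⟨(g : (E : Filter I).Germ ℕ), fun n =>
    Filter.Germ.coe_lt.2 (hg n)⟩)
  have hle' : (OrderDual.ofDual s).1 ≤ (g : (E : Filter I).Germ ℕ) := hle
  rw [← hf ⟨s, hs⟩] at hle'
  exact absurd (Filter.Germ.coe_lt.2 (hgf ⟨s, hs⟩)) (not_lt.2 hle')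

theorem exists_forall_lt_of_mk_lt_cof {o : Ordinal.{u}} {B : Set o.ToType}
    (hB : Cardinal.mk B < o.cof) : ∃ a, ∀ b ∈ B, b < a := by
  rw [← not_isCofinal_iff]
  intro h
  rw [← Ordinal.cof_toType] at hB
  exact absurd (Order.cof_le h) (not_le.2 hB)

/-! ### Large lower cofinality without saturation -/

/-- On every set of size at least `ℵ₁` there is a regular ultrafilter with large lower cofinality
that does not saturate the theory of the random graph. -/
theorem exists_isRegular_lcf_not_saturates {I : Type u} (h₁ : Cardinal.aleph 1 ≤ Cardinal.mk I) :
    ∃ D : Ultrafilter I, IsRegular (D : Filter I) ∧ Order.succ (Cardinal.mk I) ≤ lcf D ∧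
      ¬ Saturates D randomGraphTheory := by
  have h₀ : Cardinal.aleph0 ≤ Cardinal.mk I := (Cardinal.aleph0_le_aleph 1).trans h₁
  have : Infinite I := Cardinal.infinite_iff.2 h₀
  let K₁ : Type u := (Cardinal.aleph 1).ord.ToType
  let K₂ : Type u := (Order.succ (Cardinal.mk I)).ord.ToType
  -- `K₁` indexes the pairs to be kept inseparable, `K₂` the descending sequence.
  let W : Type u := K₁ ⊕ₗ K₂
  have : WellFoundedLT W := ⟨Sum.lex_wf wellFounded_lt wellFounded_lt⟩
  have hK₁ : Cardinal.mk K₁ = Cardinal.aleph 1 := by simp [K₁]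
  have hK₂ : Cardinal.mk K₂ = Order.succ (Cardinal.mk I) := by simp [K₂]
  have hK : Cardinal.mk (W × Bool) ≤ Cardinal.mk (Set I) := by
    have hsucc : Order.succ (Cardinal.mk I) ≤ Cardinal.mk (Set I) := by
      rw [Cardinal.mk_set]
      exact Order.succ_le_of_lt (Cardinal.cantor _)
    have hinf : Cardinal.aleph0 ≤ Cardinal.mk (Set I) :=
      h₀.trans ((Order.le_succ _).trans hsucc)
    have hW : Cardinal.mk W = Cardinal.mk K₁ + Cardinal.mk K₂ := by
      change Cardinal.mk (K₁ ⊕ K₂) = _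
      simp
    have hWle : Cardinal.mk W ≤ Cardinal.mk (Set I) := by
      rw [hW, hK₁, hK₂]
      exact Cardinal.add_le_of_le hinf (h₁.trans ((Order.le_succ _).trans hsucc)) hsucc
    rw [Cardinal.mk_prod, Cardinal.lift_uzero, Cardinal.mk_bool, Cardinal.lift_ofNat]
    exact Cardinal.mul_le_of_le hinf hWle ((Cardinal.natCast_lt_aleph0 (n := 2)).le.trans hinf)
  obtain ⟨e⟩ := Cardinal.le_def _ _ |>.1 hK
  obtain ⟨G, D₀, hreg, hG₀⟩ := exists_isRegular_indepMod e.injective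
  obtain ⟨D, hD, hG, hmax⟩ := hG₀.exists_maximal
  let L : Set W := Set.range Sum.inlₗ
  have hL : ∀ w, w ∉ L → ∃ ξ : K₂, w = Sum.inrₗ ξ := by
    rintro (α | ξ) hw
    · exact absurd ⟨α, rfl⟩ hw
    · exact ⟨ξ, rfl⟩
  have hL' : ∀ ξ : K₂, Sum.inrₗ ξ ∉ L := by
    rintro ξ ⟨α, h⟩
    exact absurd h (by simp)
  obtain ⟨U, hU, hlow, hhigh⟩ := exists_generic_ultrafilter L (by
    rintro _ ⟨α, rfl⟩ w hw
    obtain ⟨ξ, rfl⟩ := hL w hw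
    exact Sum.Lex.inl_lt_inr α ξ)
  obtain ⟨E, hED, hE⟩ := hG.exists_ultrafilter hmax hU
  refine ⟨E, ?_, succ_le_lcf fun S f hS hf => ?_, fun hsat => ?_⟩
  · obtain ⟨X, hX, hX'⟩ := hreg
    exact ⟨X, fun i => hED (hD (hX i)), hX'⟩
  · -- `|I|` many countable supports are bounded in `K₂`, whose order type is the regular `|I|⁺`.
    choose s hs hsf using fun i => eventually_lt_of_infinitesimal hG hmax hU hE (f i) (hf i)
    let B : Set K₂ := ⋃ i, {ξ | ∃ b, (Sum.inrₗ ξ, b) ∈ s i}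
    have hB : Cardinal.mk B < (Order.succ (Cardinal.mk I)).ord.cof := by
      rw [(Cardinal.isRegular_succ h₀).cof_ord, Order.lt_succ_iff]
      refine (Cardinal.mk_iUnion_le _).trans (Cardinal.mul_le_of_le h₀ hS (ciSup_le' fun i => ?_))
      refine le_trans (Cardinal.mk_le_aleph0_iff.2 ?_) h₀
      refine (((hs i).image Prod.fst).preimage Sum.inr_injective).mono ?_
      rintro η ⟨b, hb⟩
      exact ⟨_, hb, rfl⟩
    obtain ⟨ξ, hξ⟩ := exists_forall_lt_of_mk_lt_cof hB
    obtain ⟨hpos, hinf⟩ := hhigh (Sum.inrₗ ξ) (hL' ξ)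
    refine ⟨fun t => G t (Sum.inrₗ ξ, false), fun n => (hE _).2 ?_, fun i => ?_⟩
    · refine mem_of_superset (hpos n) fun x hx => ?_
      exact mem_forced_setOf_apply₂ (p := fun a _ => n < a) (k' := (Sum.inrₗ ξ, false)) hx
    · refine hsf i _ (hpos 0) fun P hP => hinf P fun n => (hP n).mono ?_
      rintro ⟨α | η, b⟩ hk
      · exact Sum.Lex.inl_lt_inr α ξ
      · exact Sum.Lex.inr_lt_inr_iff.2 (hξ η (Set.mem_iUnion.2 ⟨i, b, hk⟩))
  · have hne : ∀ α β : K₁, ∀ᶠ t in E,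
        G t (Sum.inlₗ α, true) ≠ G t (Sum.inlₗ β, false) := by
      intro α β
      refine (hE _).2 (mem_of_superset ?_ fun x hx =>
        mem_forced_setOf_apply₂ (p := fun a b => a ≠ b) hx)
      change {x | x (Sum.inlₗ α, true) ≠ x (Sum.inlₗ β, false)} ∈ U
      -- Apply the symmetry at the larger index to the singleton of the value at the smaller one:
      -- both coordinates there would equal that value, but they are distinct.
      rcases lt_trichotomy α β with h | rfl | h
      · filter_upwards [(hlow _ ⟨β, rfl⟩).1, (hlow _ ⟨β, rfl⟩).2
          (fun n => {x | x (Sum.inlₗ α, true) = n}) fun n x y hxy => by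
            simp only [Set.mem_ofPred_eq]
            rw [hxy _ (Or.inl (Sum.Lex.inl_lt_inl_iff.2 h))] ] with x h1 h2 h3
        exact h1 (h3.symm.trans (h2.1 h3))
      · filter_upwards [(hlow _ ⟨α, rfl⟩).1] with x hx using hx.symm
      · filter_upwards [(hlow _ ⟨α, rfl⟩).1, (hlow _ ⟨α, rfl⟩).2
          (fun n => {x | x (Sum.inlₗ β, false) = n}) fun n x y hxy => by
            simp only [Set.mem_ofPred_eq]
            rw [hxy _ (Or.inl (Sum.Lex.inl_lt_inl_iff.2 h))] ] with x h1 h2 h3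
        exact h1 ((h2.2 h3.symm).symm.trans h3.symm)
    obtain ⟨Y, hY⟩ := hsat.exists_separation (ι := K₁) (by
        rw [Cardinal.mk_prod, Cardinal.lift_uzero, Cardinal.mk_bool, hK₁, Cardinal.lift_ofNat]
        exact Cardinal.mul_le_of_le h₀ h₁ ((Cardinal.natCast_lt_aleph0 (n := 2)).le.trans h₀))
      (fun k t => G t (Sum.inlₗ k.1, k.2)) hne
    obtain ⟨s, hs, hsY⟩ := not_separated_of_symmetric hG hmax hU hE Y
    -- The countable support `s` is bounded in `K₁`, whose order type is `ω₁`.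
    have hB : Cardinal.mk {α : K₁ | ∃ b, (Sum.inlₗ α, b) ∈ s} < (Cardinal.aleph 1).ord.cof := by
      rw [Cardinal.isRegular_aleph_one.cof_ord]
      refine lt_of_le_of_lt (Cardinal.mk_le_aleph0_iff.2 ?_) Cardinal.aleph0_lt_aleph_one
      refine ((hs.image Prod.fst).preimage Sum.inl_injective).mono ?_
      rintro β ⟨b, hb⟩
      exact ⟨_, hb, rfl⟩
    obtain ⟨α, hα⟩ := exists_forall_lt_of_mk_lt_cof hB
    refine hsY (Sum.inlₗ α, true) (Sum.inlₗ α, false) (fun P hP => ?_) (hY α)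
    refine (hlow _ ⟨α, rfl⟩).2 P fun n => (hP n).mono ?_
    rintro ⟨β | ξ, b⟩ hk
    · exact Or.inl (Sum.Lex.inl_lt_inl_iff.2 (hα β ⟨b, hk⟩))
    · exact Or.inr (hL' ξ)

end RegularUltrafilter

theorem corollary6p5 {I : Type u} (hI : Cardinal.aleph 2 ≤ Cardinal.mk I) :
    ∃ D : Ultrafilter I,
      RegularUltrafilter.IsRegular (D : Filter I) ∧
      Order.succ (Cardinal.mk I) ≤ RegularUltrafilter.lcf D ∧
      ¬ RegularUltrafilter.Saturates D RegularUltrafilter.randomGraphTheory :=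
  RegularUltrafilter.exists_isRegular_lcf_not_saturates
    ((Cardinal.aleph_le_aleph.2 one_le_two).trans hI)
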